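/- \textbf{Definitions.} Let $G\colon \mathbf{Set}\to\mathbf{Set}$ be a functor. Its category of elements $\mathrm{El}(G)$ has as objects the pairs $(X,x)$ with $x\in G(X)$, and as morphisms $(X,x)\to(Y,y)$ the maps $f\colon X\to Y$ with $G(f)(x)=y$. An object $X$ of a category is \emph{transitive} if, for every object $A$, $\mathrm{Hom}(X,A)$ is non-empty and $\mathrm{Aut}(X)$ acts transitively on it by composition. A \emph{weak normal form} of an object $A$ of a category $\mathcal C$ is a transitive object of the slice category $\mathcal C/A$. The functor $G$ is \emph{analytic} if every object of $\mathrm{El}(G)$ has a weak normal form and, for every weak normal form $f\colon (Y,y)\to(X,x)$ in $\mathrm{El}(G)$, the set $Y$ is finite. The \emph{support} of $x\in G(X)$ is then $\mathrm{supp}(x)=f(Y)\subseteq X$, where $f\colon (Y,y)\to (X,x)$ is any weak normal form of $(X,x)$ (it does not depend on the choice of $f$). Let $(\mu G,\delta)$, $\delta\colon G(\mu G)\to\mu G$, be an initial algebra of $G$. The \emph{substructure ordering} $\sqsubseteq$ on $\mu G$ is the transitive closure of the relation ``$a=b$ or $a\in\mathrm{supp}(\delta^{-1}(b))$''; for $S\subseteq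 \mu G$ write ${\uparrow}_{\sqsubseteq}S=\{b : a\sqsubseteq b \text{ for some } a\in S\}$. A functor $T\colon\mathbf{Top}\to\mathbf{Top}$ is a \emph{lift} of $G$ if $U\circ T= G\circ U$ (possibly up to a fixed natural isomorphism), where $U\colon\mathbf{Top}\to\mathbf{Set}$ is the forgetful functor. A topological space is \emph{Noetherian} if all of its subsets are compact. \textbf{Theorem.} Let $T\colon\mathbf{Top}\to\mathbf{Top}$ be a lift of an analytic functor $G\colon\mathbf{Set}\to\mathbf{Set}$, and assume that $T$ maps topological embeddings to topological embeddings and Noetherian spaces to Noetherian spaces. Let $(\mu G,\delta)$ be an initial algebra of $G$. For a topology $\tau$ on $\mu G$, let $E(\tau)$ be the topology on $\mu G$ generated by the sets ${\uparrow}_{\sqsubseteq}\,\delta(V)$, where $V$ ranges over the open subsets of $T(\mu G,\tau)$. Then $E$ has a least fixed point with respect to inclusion of topologies (the \emph{divisibility topology} on $\mu G$), and this topology is Noetherian. -/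

import Mathlib

open CategoryTheory
open scoped Topology

universe u v w

/-- A transitive object: every `Hom(X, A)` is non-empty, and `Aut(X)` acts transitively on it
by composition. -/
def IsTransitiveObject {C : Type v} [Category.{w} C] (X : C) : Prop :=
  ∀ A : C, Nonempty (X ⟶ A) ∧ ∀ f g : X ⟶ A, ∃ σ : Aut X, σ.hom ≫ f = g

/-- A weak normal form of `A`: a transitive object of the slice category over `A`. -/
def IsWeakNormalForm {C : Type v} [Category.{w} C] {A : C} (f : Over A) : Prop :=
  IsTransitiveObject f

/-- Analytic functors: every object of the category of elements has a weak normal form, and the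
underlying set of (the domain of) any weak normal form is finite. -/
def IsAnalyticFunctor (G : Type u ⥤ Type u) : Prop :=
  (∀ A : G.Elements, ∃ f : Over A, IsWeakNormalForm f) ∧
    ∀ (A : G.Elements) (f : Over A), IsWeakNormalForm f → Finite f.left.1

/-- The support of `x ∈ G(X)`: the image `f(Y) ⊆ X` of a weak normal form
`f : (Y, y) ⟶ (X, x)` in the category of elements. Any two weak normal forms of the same object
are isomorphic over it, so this image does not depend on the choice of `f`. -/
def elementSupport (G : Type u ⥤ Type u) {X : Type u} (x : G.obj X) : Set X :=
  {a | ∃ f : Over (G.elementsMk X x), IsWeakNormalForm f ∧ a ∈ Set.range f.hom.val}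

/-- `a` is a child of `b` in the algebra `(A, δ)`: `a = b`, or `a` is in the support of
`δ⁻¹(b)`. -/
def IsChild (G : Type u ⥤ Type u) (A : Endofunctor.Algebra G) (a b : A.a) : Prop :=
  a = b ∨ ∃ x ∈ A.str ⁻¹' {b}, a ∈ elementSupport G x

/-- The substructure ordering `⊑`: the transitive closure of the child relation. -/
def Substructure (G : Type u ⥤ Type u) (A : Endofunctor.Algebra G) : A.a → A.a → Prop :=
  Relation.TransGen (IsChild G A)

/-- The upward closure of a set for the substructure ordering. -/
def substructureUp (G : Type u ⥤ Type u) (A : Endofunctor.Algebra G) (S : Set A.a) : Set A.a :=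
  {b | ∃ a ∈ S, Substructure G A a b}

/-- `T` is a lift to topological spaces of the endofunctor `G` of sets: the square formed with the
forgetful functor commutes, up to a given natural isomorphism (an equality of functors gives
such an isomorphism through `eqToIso`). -/
abbrev TopLift (T : TopCat.{u} ⥤ TopCat.{u}) (G : Type u ⥤ Type u) : Type (u + 1) :=
  T ⋙ forget TopCat.{u} ≅ forget TopCat.{u} ⋙ G

/-- `T` preserves topological embeddings. -/
def PreservesEmbeddings (T : TopCat.{u} ⥤ TopCat.{u}) : Prop :=
  ∀ ⦃X Y : TopCat.{u}⦄ (f : X ⟶ Y), Topology.IsEmbedding f → Topology.IsEmbedding (T.map f)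

/-- `T` preserves Noetherian spaces. -/
def PreservesNoetherian (T : TopCat.{u} ⥤ TopCat.{u}) : Prop :=
  ∀ X : TopCat.{u}, TopologicalSpace.NoetherianSpace X →
    TopologicalSpace.NoetherianSpace (T.obj X)

/-- The set `δ(U)`, for a subset `U` of the underlying set of `T(A, τ)`, which the lift identifies
with `G(A)`. -/
def strImage {T : TopCat.{u} ⥤ TopCat.{u}} {G : Type u ⥤ Type u} (e : TopLift T G)
    (A : Endofunctor.Algebra G) (τ : TopologicalSpace A.a)
    (U : Set (T.obj (@TopCat.of A.a τ))) : Set A.a :=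
  (fun t : T.obj (@TopCat.of A.a τ) => A.str (e.hom.app (@TopCat.of A.a τ) t)) '' U

/-- The map sending `τ` to the topology generated by the sets `↑_⊑ δ(U)`, for `U` open in
`T(A, τ)`. -/
@[reducible]
def divExp {T : TopCat.{u} ⥤ TopCat.{u}} {G : Type u ⥤ Type u} (e : TopLift T G)
    (A : Endofunctor.Algebra G) (τ : TopologicalSpace A.a) : TopologicalSpace A.a :=
  TopologicalSpace.generateFrom
    {V | ∃ U : Set (T.obj (@TopCat.of A.a τ)),
      IsOpen U ∧ V = substructureUp G A (strImage e A τ U)}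

theorem divExp_monotone {T : TopCat.{u} ⥤ TopCat.{u}} {G : Type u ⥤ Type u} (e : TopLift T G)
    (A : Endofunctor.Algebra G) : Monotone (divExp e A) := by
  intro σ τ h
  refine le_generateFrom ?_
  rintro V ⟨U, hU, rfl⟩
  let i : @TopCat.of A.a σ ⟶ @TopCat.of A.a τ :=
    @TopCat.ofHom A.a A.a σ τ (@ContinuousMap.mk A.a A.a σ τ id (continuous_id_iff_le.2 h))
  have hi : (forget TopCat.{u}).map i = 𝟙 A.a := rfl
  have key : ∀ t : T.obj (@TopCat.of A.a σ),
      e.hom.app (@TopCat.of A.a τ) (T.map i t) = e.hom.app (@TopCat.of A.a σ) t := by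
    intro t
    have h1 := ConcreteCategory.congr_hom (e.hom.naturality i) t
    have h2 : (forget TopCat.{u} ⋙ G).map i = 𝟙 (G.obj A.a) := by
      change G.map ((forget TopCat.{u}).map i) = _
      rw [hi, G.map_id]
    rw [h2] at h1
    exact h1
  have inj : Function.Injective (e.hom.app (@TopCat.of A.a τ)) := by
    rw [← mono_iff_injective]
    infer_instance
  have surj : Function.Surjective (e.hom.app (@TopCat.of A.a σ)) := by
    rw [← epi_iff_surjective]
    infer_instance
  refine TopologicalSpace.isOpen_generateFrom_of_mem
    ⟨T.map i ⁻¹' U, hU.preimage (T.map i).hom.continuous, ?_⟩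
  congr 1
  ext b
  constructor
  · rintro ⟨t, ht, rfl⟩
    obtain ⟨s, hs⟩ := surj (e.hom.app (@TopCat.of A.a τ) t)
    have hst : T.map i s = t := inj ((key s).trans hs)
    exact ⟨s, by rw [Set.mem_preimage, hst]; exact ht, congrArg A.str hs⟩
  · rintro ⟨s, hs, rfl⟩
    exact ⟨T.map i s, hs, congrArg A.str (key s)⟩

/-- The divisibility topology: the least fixed point of `divExp`, where topologies are ordered by
inclusion of their families of open sets. In Mathlib's order on topologies `σ ≤ τ` means that `σ`
has more open sets than `τ`, hence `gfp`. -/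
@[reducible]
def divisibilityTopology {T : TopCat.{u} ⥤ TopCat.{u}} {G : Type u ⥤ Type u} (e : TopLift T G)
    (A : Endofunctor.Algebra G) : TopologicalSpace A.a :=
  OrderHom.gfp ⟨divExp e A, divExp_monotone e A⟩

/-! The least fixed point is reached by iterating the monotone map `divExp` transfinitely from the
coarsest topology, so it suffices that every stage is Noetherian. This is a Nash-Williams minimal
bad sequence argument on subbasic open sets, ranked by the ordinal of their stage
(`not_isBadSeq_of_mem_divExpSubbasis`). Let `H n` be what the first `n` sets of a minimal bad
sequence miss. Minimality makes the topology `θ` generated by traces on `H n` of sets from stages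
below the `n`-th rank Noetherian. Since `H n` is closed under substructures, a witness of badness
yields an element of `G (H n)`. As `T` preserves embeddings, the bad sequence then transfers to open
sets of `T (A, θ)`, which is Noetherian. -/

/-! ### Bad sequences and Noetherian topologies -/

/-- A sequence of sets none of which is covered by the previous ones. -/
def IsBadSeq {X : Type*} (W : ℕ → Set X) : Prop :=
  ∀ n, ∃ x ∈ W n, ∀ i < n, x ∉ W i

theorem IsBadSeq.comp_strictMono {X : Type*} {W : ℕ → Set X} (hW : IsBadSeq W) {g : ℕ → ℕ}
    (hg : StrictMono g) : IsBadSeq (W ∘ g) := fun n =>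
  let ⟨x, hx, h⟩ := hW (g n)
  ⟨x, hx, fun i hi => h (g i) (hg hi)⟩

/-- A topology is Noetherian as soon as it has a subbasis without bad sequences. -/
theorem noetherianSpace_generateFrom {X : Type*} {S : Set (Set X)}
    (hS : ∀ W : ℕ → Set X, (∀ n, W n ∈ S) → ¬ IsBadSeq W) :
    @TopologicalSpace.NoetherianSpace X (TopologicalSpace.generateFrom S) := by
  let _ := TopologicalSpace.generateFrom S
  rw [TopologicalSpace.noetherianSpace_iff_isCompact]
  -- Alexander's subbase lemma: only covers by members of `S` matter.
  refine fun s => isCompact_generateFrom rfl fun P hP hs => ?_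
  by_contra! hQ
  -- Stated for all `Q` so that `choose` gives a total function; it is used only on finite
  -- subfamilies of `P`.
  have step (Q : Set (Set X)) : ∃ U ∈ P, Q.Finite → Q ⊆ P → ∃ x ∈ U, x ∉ ⋃₀ Q := by
    by_cases hfin : Q.Finite ∧ Q ⊆ P
    · obtain ⟨x, hxs, hxQ⟩ := Set.not_subset.1 (hQ Q hfin.2 hfin.1)
      obtain ⟨U, hU, hxU⟩ := hs hxs
      exact ⟨U, hU, fun _ _ => ⟨x, hxU, hxQ⟩⟩
    · obtain ⟨x, hxs, -⟩ := Set.not_subset.1 (hQ ∅ (Set.empty_subset _) Set.finite_empty)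
      obtain ⟨U, hU, -⟩ := hs hxs
      exact ⟨U, hU, fun h₁ h₂ => (hfin ⟨h₁, h₂⟩).elim⟩
  choose F hFP hF using step
  let C : ℕ → Set (Set X) := fun n => Nat.rec ∅ (fun _ Q => insert (F Q) Q) n
  have hC : ∀ n, (C n).Finite ∧ C n ⊆ P := by
    intro n
    induction n with
    | zero => exact ⟨Set.finite_empty, Set.empty_subset _⟩
    | succ n ih => exact ⟨ih.1.insert _, Set.insert_subset (hFP _) ih.2⟩
  have hmono : Monotone C := monotone_nat_of_le_succ fun n => Set.subset_insert _ _
  refine hS (fun n => F (C n)) (fun n => hP (hFP _)) fun n => ?_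
  obtain ⟨x, hx, hx'⟩ := hF (C n) (hC n).1 (hC n).2
  exact ⟨x, hx, fun i hi hxi =>
    hx' ⟨F (C i), hmono (Nat.succ_le_of_lt hi) (Set.mem_insert _ _), hxi⟩⟩

theorem TopologicalSpace.NoetherianSpace.not_isBadSeq {X : Type*} [TopologicalSpace X]
    [TopologicalSpace.NoetherianSpace X] {W : ℕ → Set X} (hW : ∀ n, IsOpen (W n)) :
    ¬ IsBadSeq W := by
  intro hbad
  obtain ⟨t, ht⟩ := (TopologicalSpace.NoetherianSpace.isCompact (⋃ n, W n)).elim_finite_subcover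
    W hW subset_rfl
  obtain ⟨N, hN⟩ := t.exists_nat_subset_range
  obtain ⟨x, hx, hx'⟩ := hbad N
  obtain ⟨i, hi, hxi⟩ := Set.mem_iUnion₂.1 (ht (Set.mem_iUnion.2 ⟨N, hx⟩))
  exact hx' i (Finset.mem_range.1 (hN hi)) hxi

/-- Lexicographically minimal sequences: if a property of sequences holds as soon as every finite
prefix extends to a sequence with the property, then some sequence with this property has minimal
rank at each index among those that share the previous terms. -/
theorem exists_lex_minimal_seq {α ι : Type*} [LinearOrder ι] [WellFoundedLT ι] (rk : α → ι)
    (P : (ℕ → α) → Prop)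
    (hP : ∀ g, (∀ n, ∃ f, P f ∧ ∀ m ≤ n, f m = g m) → P g) (hne : ∃ f, P f) :
    ∃ g, P g ∧ ∀ n f, P f → (∀ m < n, f m = g m) → rk (g n) ≤ rk (f n) := by
  have step (n : ℕ) (f : {f // P f}) : ∃ g : {f // P f}, (∀ m < n, g.1 m = f.1 m) ∧
      ∀ h, P h → (∀ m < n, h m = f.1 m) → rk (g.1 n) ≤ rk (h n) := by
    obtain ⟨g, hg, hmin⟩ := exists_minimalFor_of_wellFoundedLT
      (fun g : {f // P f} => ∀ m < n, g.1 m = f.1 m) (fun g => rk (g.1 n)) ⟨f, fun _ _ => rfl⟩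
    exact ⟨g, hg, fun h hh hm => (le_total _ _).elim id fun hle => hmin (j := ⟨h, hh⟩) hm hle⟩
  choose S hS hSmin using step
  obtain ⟨f₀, hf₀⟩ := hne
  let F : ℕ → {f // P f} := fun n => Nat.rec (S 0 ⟨f₀, hf₀⟩) (fun n f => S (n + 1) f) n
  have hF : ∀ n k m, m ≤ n → (F (n + k)).1 m = (F n).1 m := by
    intro n k m hm
    induction k with
    | zero => rfl
    | succ k ih => exact (hS (n + k + 1) (F (n + k)) m (by omega)).trans ih
  have hF' : ∀ n m, m ≤ n → (F n).1 m = (F m).1 m := by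
    intro n m hm
    obtain ⟨k, rfl⟩ := Nat.exists_eq_add_of_le hm
    exact hF m k m le_rfl
  -- The diagonal agrees with `F n` up to index `n`, so `hP` applies.
  refine ⟨fun n => (F n).1 n, hP _ fun n => ⟨(F n).1, (F n).2, hF' n⟩, fun n f hf hfm => ?_⟩
  cases n with
  | zero => exact hSmin 0 _ f hf (by simp)
  | succ n =>
    exact hSmin (n + 1) (F n) f hf fun m hm => (hfm m hm).trans (hF' n m (by omega)).symm

/-! ### Substructures, supports and lifts -/

theorem substructureUp_self {G : Type u ⥤ Type u} {A : Endofunctor.Algebra G} {S : Set A.a}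
    {a : A.a} (ha : a ∈ S) : a ∈ substructureUp G A S :=
  ⟨a, ha, .single (Or.inl rfl)⟩

theorem substructureUp_of_substructure {G : Type u ⥤ Type u} {A : Endofunctor.Algebra G}
    {S : Set A.a} {a b : A.a} (ha : a ∈ substructureUp G A S) (h : Substructure G A a b) :
    b ∈ substructureUp G A S :=
  let ⟨c, hc, hca⟩ := ha
  ⟨c, hc, hca.trans h⟩

/-- An element of `G X` comes from `G H` if its support is included in `H`. -/
theorem exists_map_subtypeVal_eq {G : Type u ⥤ Type u} (hG : IsAnalyticFunctor G) {X : Type u}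
    (x : G.obj X) {H : Set X} (hH : elementSupport G x ⊆ H) :
    ∃ h : G.obj H, G.map (↾(Subtype.val : H → X)) h = x := by
  obtain ⟨f, hf⟩ := hG.1 (G.elementsMk X x)
  have hmem : ∀ y, f.hom.val y ∈ H := fun y => hH ⟨f, hf, y, rfl⟩
  let g : f.left.1 ⟶ (H : Type u) := ↾fun y => ⟨f.hom.val y, hmem y⟩
  have hg : g ≫ ↾(Subtype.val : H → X) = f.hom.val := by ext y; rfl
  refine ⟨G.map g f.left.2, ?_⟩
  have h := f.hom.2
  rw [← hg, G.map_comp] at h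
  exact h

section Lift

variable {T : TopCat.{u} ⥤ TopCat.{u}} {G : Type u ⥤ Type u} (e : TopLift T G)

theorem TopLift.map_inv_app {X Y : TopCat.{u}} (f : X ⟶ Y) (x : G.obj X) :
    T.map f (e.inv.app X x) = e.inv.app Y (G.map ((forget TopCat.{u}).map f) x) :=
  (ConcreteCategory.congr_hom (e.inv.naturality f) x).symm

theorem TopLift.hom_inv_app (X : TopCat.{u}) (x : G.obj X) :
    e.hom.app X (e.inv.app X x) = x :=
  ConcreteCategory.congr_hom (e.inv_hom_id_app X) x

theorem TopLift.inv_hom_app (X : TopCat.{u}) (t : T.obj X) :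
    e.inv.app X (e.hom.app X t) = t :=
  ConcreteCategory.congr_hom (e.hom_inv_id_app X) t

theorem mem_strImage_iff {A : Endofunctor.Algebra G} {τ : TopologicalSpace A.a}
    {U : Set (T.obj (@TopCat.of A.a τ))} {a : A.a} :
    a ∈ strImage e A τ U ↔ ∃ x : G.obj A.a, e.inv.app (@TopCat.of A.a τ) x ∈ U ∧ A.str x = a := by
  constructor
  · rintro ⟨t, ht, rfl⟩
    exact ⟨e.hom.app _ t, by rwa [e.inv_hom_app], rfl⟩
  · rintro ⟨x, hx, rfl⟩
    exact ⟨_, hx, congrArg A.str (e.hom_inv_app (@TopCat.of A.a τ) x)⟩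

/-- If `θ` refines `σ` on a subset `H`, then every open subset of `T (X, σ)` has the same trace
on `G H` as some open subset of `T (X, θ)`. -/
theorem exists_isOpen_inv_app_mem_iff (hemb : PreservesEmbeddings T) {X : Type u}
    (σ θ : TopologicalSpace X) (H : Set X)
    (hle : θ.induced (Subtype.val : H → X) ≤ σ.induced Subtype.val)
    {V : Set (T.obj (@TopCat.of X σ))} (hV : IsOpen V) :
    ∃ V' : Set (T.obj (@TopCat.of X θ)), IsOpen V' ∧ ∀ h : G.obj H,
      e.inv.app (@TopCat.of X θ) (G.map (↾(Subtype.val : H → X)) h) ∈ V' ↔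
        e.inv.app (@TopCat.of X σ) (G.map (↾(Subtype.val : H → X)) h) ∈ V := by
  let incl (ρ : TopologicalSpace X) :
      @TopCat.of H (ρ.induced Subtype.val) ⟶ @TopCat.of X ρ :=
    @TopCat.ofHom H X (ρ.induced Subtype.val) ρ
      (@ContinuousMap.mk H X (ρ.induced Subtype.val) ρ Subtype.val continuous_induced_dom)
  let j : @TopCat.of H (θ.induced Subtype.val) ⟶ @TopCat.of H (σ.induced Subtype.val) :=
    @TopCat.ofHom H H (θ.induced Subtype.val) (σ.induced Subtype.val)
      (@ContinuousMap.mk H H (θ.induced Subtype.val) (σ.induced Subtype.val) id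
        (continuous_id_iff_le.2 hle))
  have hemb' : Topology.IsEmbedding (T.map (incl θ)) := by
    refine hemb _ ?_
    let _ := θ
    exact Topology.IsEmbedding.subtypeVal
  -- The trace of `V` is open in `T (H, θ)`, hence induced from `T (X, θ)` by the embedding.
  obtain ⟨V', hV', hpre⟩ := hemb'.isOpen_iff.1
    (hV.preimage (T.map (j ≫ incl σ)).hom.continuous)
  refine ⟨V', hV', fun h => ?_⟩
  have key := Set.ext_iff.1 hpre (e.inv.app (@TopCat.of H (θ.induced Subtype.val)) h)
  have h1 := e.map_inv_app (incl θ) h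
  have h2 := e.map_inv_app (j ≫ incl σ) h
  change T.map (incl θ) _ ∈ V' ↔ T.map (j ≫ incl σ) _ ∈ V at key
  rw [h1, h2] at key
  exact key

variable (A : Endofunctor.Algebra G)

/-! ### Transfinite stages and the minimal bad sequence -/

/-- The subbasis of `divExp e A τ`. -/
def divExpSubbasis (τ : TopologicalSpace A.a) : Set (Set A.a) :=
  {V | ∃ U : Set (T.obj (@TopCat.of A.a τ)), IsOpen U ∧ V = substructureUp G A (strImage e A τ U)}

/-- The stages of the transfinite iteration of `divExp` from the coarsest topology. -/
@[reducible]
def divStage (b : Ordinal.{u}) : TopologicalSpace A.a :=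
  OrdinalApprox.gfpApprox ⟨divExp e A, divExp_monotone e A⟩ ⊤ b

theorem divStage_eq_generateFrom (a : Ordinal.{u}) :
    divStage e A a =
      TopologicalSpace.generateFrom {W | ∃ b < a, W ∈ divExpSubbasis e A (divStage e A b)} := by
  rw [divStage, OrdinalApprox.gfpApprox, top_inf_eq]
  refine le_antisymm (le_generateFrom ?_) (le_iInf₂ fun b hb => le_generateFrom fun W hW => ?_)
  · rintro W ⟨b, hb, hW⟩
    have hle : (⨅ b < a, divExp e A (divStage e A b)) ≤ divExp e A (divStage e A b) :=
      iInf₂_le b hb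
    exact hle W (TopologicalSpace.isOpen_generateFrom_of_mem hW)
  · exact TopologicalSpace.isOpen_generateFrom_of_mem ⟨b, hb, hW⟩

variable {A}

/-- No bad sequence can be made of subbasic open sets of the stages: in a minimal one, restricting
each set to the complement of the previous ones would produce a Noetherian topology `θ` such that
`T (A, θ)` has a bad sequence of open sets. -/
theorem not_isBadSeq_of_mem_divExpSubbasis (hG : IsAnalyticFunctor G)
    (hemb : PreservesEmbeddings T) (hnoeth : PreservesNoetherian T) (W : ℕ → Set A.a)
    (hW : ∀ n, ∃ b, W n ∈ divExpSubbasis e A (divStage e A b)) : ¬ IsBadSeq W := by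
  intro hbad
  choose b hb using hW
  obtain ⟨g, ⟨hgmem, hgbad⟩, hgmin⟩ := exists_lex_minimal_seq
    (α := Ordinal.{u} × Set A.a) Prod.fst
    (fun f => (∀ n, (f n).2 ∈ divExpSubbasis e A (divStage e A (f n).1)) ∧
      IsBadSeq fun n => (f n).2)
    -- Both conditions at index `n` involve only the terms up to `n`.
    (by
      intro g hg
      refine ⟨fun n => ?_, fun n => ?_⟩
      · obtain ⟨f, hf, hfg⟩ := hg n
        rw [← hfg n le_rfl]
        exact hf.1 n
      · obtain ⟨f, hf, hfg⟩ := hg n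
        obtain ⟨x, hx, hx'⟩ := hf.2 n
        refine ⟨x, by simpa only [hfg n le_rfl] using hx, fun i hi => ?_⟩
        simpa only [hfg i hi.le] using hx' i hi)
    ⟨fun n => (b n, W n), hb, hbad⟩
  let H : ℕ → Set A.a := fun n => {x | ∀ i < n, x ∉ (g i).2}
  have hHanti : ∀ {m n}, m ≤ n → H n ⊆ H m := fun hmn x hx i hi => hx i (hi.trans_le hmn)
  let D : Set (Set A.a) := {W | ∃ n, ∃ c < (g n).1, ∃ U ∈ divExpSubbasis e A (divStage e A c),
    W = U ∩ H n}
  let θ : TopologicalSpace A.a := TopologicalSpace.generateFrom D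
  have hθ : @TopologicalSpace.NoetherianSpace A.a θ := by
    refine noetherianSpace_generateFrom fun Z hZ hZbad => ?_
    choose N c hc U hU hZU using hZ
    -- Along a monotone `N` the sets `H (N _)` shrink.
    obtain ⟨φ, hφ⟩ := (wellQuasiOrdered_le (α := ℕ)).exists_monotone_subseq N
    have hZφ : IsBadSeq fun k => (U (φ k) ∩ H (N (φ k))) := by
      have := hZbad.comp_strictMono φ.strictMono
      simpa only [Function.comp_def, hZU] using this
    let m := N (φ 0)
    -- Splice: keep the first `m` minimal terms, then continue with the `U`'s. The rank at `m`
    -- becomes `c (φ 0) < (g m).1`, against minimality.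
    let f : ℕ → Ordinal.{u} × Set A.a := fun k =>
      if k < m then g k else (c (φ (k - m)), U (φ (k - m)))
    have hflt : ∀ k < m, f k = g k := fun k hk => if_pos hk
    have hfge : ∀ k, ¬ k < m → f k = (c (φ (k - m)), U (φ (k - m))) := fun k hk => if_neg hk
    have hle := hgmin m f ⟨fun k => ?_, fun k => ?_⟩ hflt
    · rw [hfge m (lt_irrefl m), Nat.sub_self] at hle
      exact (hc (φ 0)).not_ge hle
    · by_cases hk : k < m
      · rw [hflt k hk]; exact hgmem k
      · rw [hfge k hk]; exact hU _
    · by_cases hk : k < m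
      · obtain ⟨x, hx, hx'⟩ := hgbad k
        refine ⟨x, by simpa only [hflt k hk] using hx, fun i hi => ?_⟩
        simpa only [hflt i (hi.trans hk)] using hx' i hi
      · obtain ⟨x, hx, hx'⟩ := hZφ (k - m)
        refine ⟨x, by simpa only [hfge k hk] using hx.1, fun i hi => ?_⟩
        by_cases him : i < m
        -- Points of `H m` avoid the kept terms.
        · simpa only [hflt i him] using hHanti (hφ 0 (k - m) (Nat.zero_le _)) hx.2 i him
        · simp only [hfge i him]
          intro hxi
          -- Since `x` also lies in the earlier, larger `H`, missing the trace means missing `U`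
          -- itself.
          exact hx' (i - m) (by omega) ⟨hxi, hHanti (hφ (i - m) (k - m) (by omega)) hx.2⟩
  have hle : ∀ n, θ.induced (Subtype.val : H n → A.a) ≤
      (divStage e A (g n).1).induced Subtype.val := by
    intro n
    rw [divStage_eq_generateFrom e A (g n).1,
      induced_generateFrom_eq (b := {W | ∃ b < (g n).1, W ∈ divExpSubbasis e A (divStage e A b)})]
    refine le_generateFrom ?_
    rintro _ ⟨U, ⟨c, hc, hU⟩, rfl⟩
    refine ⟨U ∩ H n, TopologicalSpace.isOpen_generateFrom_of_mem ⟨n, c, hc, U, hU, rfl⟩, ?_⟩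
    ext x
    simp
  choose V hV hgV using hgmem
  choose V' hV' hVV' using fun n =>
    exists_isOpen_inv_app_mem_iff e hemb (divStage e A (g n).1) θ (H n) (hle n) (hV n)
  have hTθ := hnoeth (@TopCat.of A.a θ) hθ
  refine hTθ.not_isBadSeq hV' fun n => ?_
  obtain ⟨x, hx, hxH⟩ := hgbad n
  simp only [hgV n] at hx
  obtain ⟨y, hy, hyx⟩ := hx
  obtain ⟨v, hv, rfl⟩ := (mem_strImage_iff e).1 hy
  have hdown : ∀ z, Substructure G A z x → z ∈ H n := by
    intro z hz i hi hzi
    rw [hgV i] at hzi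
    exact hxH i hi (by simpa only [hgV i] using substructureUp_of_substructure hzi hz)
  -- The support of `v` consists of substructures of `A.str v`, hence of `x`, so it lies in `H n`.
  obtain ⟨h, rfl⟩ := exists_map_subtypeVal_eq hG v (H := H n) fun a ha =>
    hdown a (.head (Or.inr ⟨v, rfl, ha⟩) hyx)
  refine ⟨e.inv.app (@TopCat.of A.a θ) (G.map (↾(Subtype.val : H n → A.a)) h),
    (hVV' n h).2 hv, fun i hi hmem => ?_⟩
  -- `V' i` is controlled only on `G (H i)`, so `h` is moved there along `H n ⊆ H i`.
  let k : (H n : Type u) ⟶ (H i : Type u) := ↾Set.inclusion (hHanti hi.le)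
  have hk : G.map (↾(Subtype.val : H i → A.a)) (G.map k h) =
      G.map (↾(Subtype.val : H n → A.a)) h := by
    rw [← ConcreteCategory.comp_apply, ← G.map_comp]
    rfl
  rw [← hk, hVV' i, hk] at hmem
  refine hdown _ hyx i hi ?_
  rw [hgV i]
  exact substructureUp_self ((mem_strImage_iff e).2 ⟨_, hmem, rfl⟩)

theorem noetherianSpace_divStage (hG : IsAnalyticFunctor G) (hemb : PreservesEmbeddings T)
    (hnoeth : PreservesNoetherian T) (a : Ordinal.{u}) :
    @TopologicalSpace.NoetherianSpace A.a (divStage e A a) := by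
  rw [divStage_eq_generateFrom]
  exact noetherianSpace_generateFrom fun W hW =>
    not_isBadSeq_of_mem_divExpSubbasis e hG hemb hnoeth W fun n =>
      let ⟨b, _, hb⟩ := hW n
      ⟨b, hb⟩

end Lift

theorem mainTheorem3 (T : TopCat.{u} ⥤ TopCat.{u}) (G : Type u ⥤ Type u) (e : TopLift T G)
    (hG : IsAnalyticFunctor G) (hemb : PreservesEmbeddings T) (hnoeth : PreservesNoetherian T)
    (A : Endofunctor.Algebra G) (hA : Limits.IsInitial A) :
    (divExp e A (divisibilityTopology e A) = divisibilityTopology e A ∧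
      ∀ τ : TopologicalSpace A.a, divExp e A τ = τ →
        ∀ U : Set A.a, IsOpen[divisibilityTopology e A] U → IsOpen[τ] U) ∧
    @TopologicalSpace.NoetherianSpace A.a (divisibilityTopology e A) := by
  let E : TopologicalSpace A.a →o TopologicalSpace A.a := ⟨divExp e A, divExp_monotone e A⟩
  refine ⟨⟨E.map_gfp, fun τ hτ U hU => ?_⟩, ?_⟩
  · exact E.le_gfp (a := τ) hτ.ge U hU
  -- The iteration attains the fixed point at some ordinal.
  · obtain ⟨a, ha⟩ := OrdinalApprox.gfp_mem_range_gfpApprox E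
    have h := noetherianSpace_divStage (A := A) e hG hemb hnoeth a
    have hdiv : divStage e A a = divisibilityTopology e A := ha
    rwa [hdiv] at h
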